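/- Let $k>\ell\ge 1$ be coprime integers and let $A,B\in\mathbb C[z]$ be nonzero polynomials with $\deg(AB)\ge 1$. Let $(P_n)$ be the sequence of polynomials in $\mathbb C[z]$ with $P_0=1$, $P_n=0$ for $n<0$, and $$P_n(z)+B(z)P_{n-\ell}(z)+A(z)P_{n-k}(z)=0\qquad(n\ge 1).$$ For $z_0\in\mathbb C$ put $D(t;z_0)=A(z_0)t^k+B(z_0)t^\ell+1$. Let $X=\{w\in\mathbb C: w\ne 0,\ w^\ell\ne 1,\ w^{k-\ell}\ne 1\}$ and, for $w\in X$, $$h(w)=\frac{(1-w^k)^k}{(1-w^\ell)^\ell\,(w^\ell-w^k)^{k-\ell}}.$$ Let $z_0\in\mathbb C$ be a zero of some $P_n$ that is not the zero polynomial, with $A(z_0)\neq 0$, and let $q=t_1/t_2$ be a ratio of two distinct zeros $t_1\ne t_2$ of $D(t;z_0)$. Then $q\in X$, and $h(q)$ is real if and only if at least one of the following holds: 1. $q\in(\mathbb R\cup\{w\in\mathbb C:|w|=1\})\cap X$; 2. there is a ratio $q'\neq q$ of two distinct zeros of $D(t;z_0)$ with $q'\in(\mathbb R\cup\{w\in\mathbb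 C:|w|=1\})\cap X$. -/

import Mathlib

noncomputable section

namespace TrinomialRatio

open Polynomial

/-- The terms `P_n`, `n ≥ 0`, of the sequence with `P_0 = 1`, `P_n = 0` for `n < 0` and
`P_n + B P_{n-l} + A P_{n-k} = 0` for `n ≥ 1`; a term of negative index is omitted from the
recursion. (The conditions `1 ≤ l`, `1 ≤ k` only make the recursion well-founded.) -/
def seqNat (A B : ℂ[X]) (k l : ℕ) : ℕ → ℂ[X]
  | 0 => 1
  | n + 1 =>
      -(if _h : 1 ≤ l ∧ l ≤ n + 1 then B * seqNat A B k l (n + 1 - l) else 0)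
        - (if _h : 1 ≤ k ∧ k ≤ n + 1 then A * seqNat A B k l (n + 1 - k) else 0)
  termination_by n => n
  decreasing_by all_goals omega

/-- The polynomial sequence `P_n`, indexed by the integers, with `P_n = 0` for `n < 0`. -/
def seqP (A B : ℂ[X]) (k l : ℕ) (n : ℤ) : ℂ[X] :=
  if 0 ≤ n then seqNat A B k l n.toNat else 0

theorem seqP_zero (A B : ℂ[X]) (k l : ℕ) : seqP A B k l 0 = 1 := by
  simp [seqP, seqNat]

theorem seqP_neg (A B : ℂ[X]) (k l : ℕ) (n : ℤ) (hn : n < 0) : seqP A B k l n = 0 := by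
  simp [seqP, not_le.mpr hn]

/-- The three-term recurrence. -/
theorem seqP_rec (A B : ℂ[X]) (k l : ℕ) (hk : 1 ≤ k) (hl : 1 ≤ l) (n : ℤ) (hn : 1 ≤ n) :
    seqP A B k l n + B * seqP A B k l (n - l) + A * seqP A B k l (n - k) = 0 := by
  obtain ⟨m, rfl⟩ : ∃ m : ℕ, n = ((m + 1 : ℕ) : ℤ) := ⟨n.toNat - 1, by omega⟩
  have key : ∀ j : ℕ, 1 ≤ j → ∀ C : ℂ[X], C * seqP A B k l (((m + 1 : ℕ) : ℤ) - j) =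
      if 1 ≤ j ∧ j ≤ m + 1 then C * seqNat A B k l (m + 1 - j) else 0 := by
    intro j hj C
    by_cases h : j ≤ m + 1
    · have e : (((m + 1 : ℕ) : ℤ) - j).toNat = m + 1 - j := by omega
      have p : (0 : ℤ) ≤ ((m + 1 : ℕ) : ℤ) - j := by omega
      rw [seqP, if_pos p, e, if_pos ⟨hj, h⟩]
    · rw [seqP_neg _ _ _ _ _ (by omega), if_neg (fun c => h c.2), mul_zero]
  have h0 : seqP A B k l ((m + 1 : ℕ) : ℤ) = seqNat A B k l (m + 1) := by
    rw [seqP, if_pos (by omega), Int.toNat_natCast]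
  rw [key l hl, key k hk, h0, seqNat]
  simp only [dite_eq_ite]
  ring

/-- The set of all zeros of the nonzero polynomials in `S`. -/
def zerosOf (S : Set ℂ[X]) : Set ℂ :=
  {z | ∃ p ∈ S, p ≠ 0 ∧ p.IsRoot z}

/-- The trinomial `D(t; z₀) = A(z₀) t^k + B(z₀) t^l + 1`, a polynomial in `t`. -/
def trinomialD (A B : ℂ[X]) (k l : ℕ) (z₀ : ℂ) : ℂ[X] :=
  C (A.eval z₀) * X ^ k + C (B.eval z₀) * X ^ l + 1

/-- The ratios `t₁ / t₂` of distinct zeros of `D` (for the polynomials `D` used here `0` is not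
a zero, so that the quotient is a genuine one). -/
def distinctZeroRatios (D : ℂ[X]) : Set ℂ :=
  {q | ∃ t₁ t₂ : ℂ, D.IsRoot t₁ ∧ D.IsRoot t₂ ∧ t₁ ≠ t₂ ∧ q = t₁ / t₂}

/-- The domain `ℂ ∖ (μ_l ∪ μ_{k-l} ∪ {0})` of the rational function `h`. -/
def domH (k l : ℕ) : Set ℂ :=
  {w | w ≠ 0 ∧ w ^ l ≠ 1 ∧ w ^ (k - l) ≠ 1}

/-- The rational function `h`; its value is meaningful on `domH k l`. -/
def h (k l : ℕ) (w : ℂ) : ℂ :=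
  (1 - w ^ k) ^ k / ((1 - w ^ l) ^ l * (w ^ l - w ^ k) ^ (k - l))

/-- `ℝ ∪ {|w| = 1}` as a subset of `ℂ`. -/
def realOrCircle : Set ℂ :=
  {w | w.im = 0 ∨ ‖w‖ = 1}

/-- `domH k l` is exactly the set where the denominator of `h` does not vanish. -/
theorem mem_domH_iff (k l : ℕ) (hl : 1 ≤ l) (hlk : l < k) (w : ℂ) :
    w ∈ domH k l ↔ (1 - w ^ l) ^ l * (w ^ l - w ^ k) ^ (k - l) ≠ 0 := by
  have h1 : l ≠ 0 := by omega
  have h2 : k - l ≠ 0 := by omega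
  have h3 : w ^ l - w ^ k = w ^ l * (1 - w ^ (k - l)) := by
    rw [mul_sub, ← pow_add, Nat.add_sub_cancel' hlk.le, mul_one]
  rw [h3]
  simp only [domH, Set.mem_ofPred_eq, ne_eq, mul_eq_zero, pow_eq_zero_iff h1, pow_eq_zero_iff h2,
    sub_eq_zero, @eq_comm ℂ 1]
  tauto

end TrinomialRatio

end

namespace TrinomialRatio

open Polynomial ComplexConjugate

/-! Put a = A(z₀), b = B(z₀). All ratios of distinct zeros of D share the single value h = (-1)^k
b^k / a^l (`h_eq_of_trinomial`). Since h commutes with conjugation and is invariant under inversion,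
it is real on the real line and the unit circle, so one such ratio makes h(q) real. Conversely, if
b^k / a^l is real, coprimality yields a rescaling of t making D real (`exists_scaling_real`): either
both rescaled zeros are real, and so is q, or a nonreal one and its conjugate have a ratio of
modulus 1. -/

theorem isRoot_trinomialD_iff (A B : ℂ[X]) (k l : ℕ) (z₀ t : ℂ) :
    (trinomialD A B k l z₀).IsRoot t ↔ A.eval z₀ * t ^ k + B.eval z₀ * t ^ l + 1 = 0 := by
  simp [trinomialD, IsRoot.def]

/-- A zero of a trinomial `a t ^ k + b t ^ l + 1` of positive exponents is nonzero. -/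
theorem ne_zero_of_trinomial_eq_zero {k l : ℕ} (hk : k ≠ 0) (hl : l ≠ 0) {a b t : ℂ}
    (h : a * t ^ k + b * t ^ l + 1 = 0) : t ≠ 0 := by
  rintro rfl
  simp [hk, hl] at h

/-- The ratio `q` of two zeros `q * t ≠ t` of a trinomial `a t ^ k + b t ^ l + 1` with `a ≠ 0` lies
in the domain of `h`. -/
theorem mem_domH_of_trinomial {k l : ℕ} (hlk : l < k) (hkl : k.Coprime l)
    {a b t q : ℂ} (ha : a ≠ 0) (ht : t ≠ 0) (hq0 : q ≠ 0) (hq1 : q ≠ 1)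
    (h₁ : a * (q * t) ^ k + b * (q * t) ^ l + 1 = 0) (h₂ : a * t ^ k + b * t ^ l + 1 = 0) :
    q ∈ domH k l := by
  -- Eliminates b between the two equations.
  have hrel : a * t ^ k * (q ^ l - q ^ k) = 1 - q ^ l := by
    rw [mul_pow, mul_pow] at h₁
    linear_combination q ^ l * h₂ - h₁
  have hsplit : q ^ k = q ^ l * q ^ (k - l) := by
    rw [← pow_add, Nat.add_sub_cancel' hlk.le]
  have hql : q ^ l ≠ 1 := by
    intro hl1
    have hk1 : q ^ k = 1 := by
      rw [hl1, sub_self, mul_eq_zero, sub_eq_zero] at hrel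
      exact (hrel.resolve_left (mul_ne_zero ha (pow_ne_zero _ ht))).symm
    have h1 := pow_gcd_eq_one.mpr ⟨hk1, hl1⟩
    rw [hkl.gcd_eq_one, pow_one] at h1
    exact hq1 h1
  refine ⟨hq0, hql, fun hm => hql ?_⟩
  rw [hm, mul_one] at hsplit
  rw [hsplit, sub_self, mul_zero] at hrel
  exact (sub_eq_zero.mp hrel.symm).symm

/-- The value of `h` at a ratio of two zeros of `a t ^ k + b t ^ l + 1` depends only on the
coefficients. -/
theorem h_eq_of_trinomial {k l : ℕ} (hl : 1 ≤ l) (hlk : l < k)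
    {a b t q : ℂ} (ha : a ≠ 0) (hq : q ∈ domH k l)
    (h₁ : a * (q * t) ^ k + b * (q * t) ^ l + 1 = 0) (h₂ : a * t ^ k + b * t ^ l + 1 = 0) :
    h k l q = (-1) ^ k * (b ^ k / a ^ l) := by
  have hden := (mem_domH_iff k l hl hlk q).mp hq
  rw [mul_pow, mul_pow] at h₁
  -- `e1` eliminates b and `e2` eliminates a; the powers of t and of q^l - q^k then cancel in h.
  have e1 : 1 - q ^ l = a * t ^ k * (q ^ l - q ^ k) := by
    linear_combination h₁ - q ^ l * h₂
  have e2 : 1 - q ^ k = -1 * (b * t ^ l * (q ^ l - q ^ k)) := by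
    linear_combination h₁ - q ^ k * h₂
  rw [h, div_eq_iff hden, e1, e2]
  have hU : (q ^ l - q ^ k) ^ k = (q ^ l - q ^ k) ^ l * (q ^ l - q ^ k) ^ (k - l) := by
    rw [← pow_add, Nat.add_sub_cancel' hlk.le]
  have hal : a ^ l ≠ 0 := pow_ne_zero _ ha
  simp only [mul_pow, hU]
  field_simp
  ring

theorem conj_h (k l : ℕ) (w : ℂ) : conj (h k l w) = h k l (conj w) := by
  simp [h]

/-- The function `h` is invariant under inversion. -/
theorem h_inv {k l : ℕ} (hlk : l ≤ k) {w : ℂ} (hw : w ≠ 0) : h k l w⁻¹ = h k l w := by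
  obtain ⟨m, rfl⟩ := Nat.exists_eq_add_of_le hlk
  have e1 : 1 - w⁻¹ ^ (l + m) = -1 * (1 - w ^ (l + m)) * (w ^ (l + m))⁻¹ := by
    rw [inv_pow]
    field_simp
    ring
  have e2 : 1 - w⁻¹ ^ l = -1 * (1 - w ^ l) * (w ^ l)⁻¹ := by
    rw [inv_pow]
    field_simp
    ring
  have e3 : w⁻¹ ^ l - w⁻¹ ^ (l + m) =
      -1 * (w ^ l - w ^ (l + m)) * (w ^ (l + l + m))⁻¹ := by
    have : w ^ (l + l + m) = w ^ l * w ^ (l + m) := by rw [← pow_add, add_assoc]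
    rw [this, inv_pow, inv_pow]
    field_simp
    ring
  -- The powers of w balance because k² = l² + (k + l)(k - l), with m = k - l.
  have hexp : (w ^ (l + m)) ^ (l + m) = (w ^ l) ^ l * (w ^ (l + l + m)) ^ m := by
    simp only [← pow_mul, ← pow_add]
    congr 1
    ring
  have hd : ((-1 : ℂ) ^ (l + m) * ((w ^ (l + m)) ^ (l + m))⁻¹) ≠ 0 :=
    mul_ne_zero (pow_ne_zero _ (by norm_num))
      (inv_ne_zero (pow_ne_zero _ (pow_ne_zero _ hw)))
  rw [h, h, e1, e2, e3, Nat.add_sub_cancel_left]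
  refine Eq.trans ?_ (mul_div_mul_left _ _ hd)
  congr 1
  · simp only [mul_pow, inv_pow]
    ring
  · rw [hexp]
    simp only [mul_pow, inv_pow, pow_add (-1 : ℂ), mul_inv]
    ring

/-- The function `h` is real on the real line and on the unit circle. -/
theorem h_im_eq_zero {k l : ℕ} (hlk : l ≤ k) {w : ℂ} (hw : w ∈ realOrCircle) :
    (h k l w).im = 0 := by
  rw [← Complex.conj_eq_iff_im, conj_h]
  rcases hw with hw | hw
  · rw [Complex.conj_eq_iff_im.mpr hw]
  · rw [← Complex.inv_eq_conj hw, h_inv hlk]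
    rintro rfl
    simp at hw

/-- If `b ^ k / a ^ l` is real, then a change of variable `t = c * s` makes the coefficients of
`a t ^ k + b t ^ l + 1` real. -/
theorem exists_scaling_real {k l : ℕ} (hkl : k.Coprime l) {a b : ℂ} (ha : a ≠ 0)
    (hb : b ≠ 0) (hr : (b ^ k / a ^ l).im = 0) :
    ∃ c : ℂ, c ≠ 0 ∧ (a * c ^ k).im = 0 ∧ (b * c ^ l).im = 0 := by
  obtain ⟨x, y, hxy⟩ := Int.isCoprime_iff_gcd_eq_one.mpr (by simpa using hkl : Int.gcd k l = 1)
  have hreal (n : ℤ) : ((b ^ k / a ^ l) ^ n).im = 0 := by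
    rw [← Complex.conj_eq_iff_im] at hr ⊢
    rw [map_zpow₀, hr]
  -- With r = b^k / a^l, the Bézout relation xk + yl = 1 gives a c^k = r^(-y) and b c^l = r^x.
  refine ⟨a ^ (-x) * b ^ (-y), mul_ne_zero (zpow_ne_zero _ ha) (zpow_ne_zero _ hb), ?_, ?_⟩
  · convert hreal (-y) using 2
    simp only [← zpow_natCast, mul_zpow, div_zpow, ← zpow_mul]
    rw [div_eq_mul_inv, ← zpow_neg, ← mul_assoc, ← zpow_one_add₀ ha, mul_comm]
    congr 2
    · ring
    · linear_combination -hxy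
  · convert hreal x using 2
    simp only [← zpow_natCast, mul_zpow, div_zpow, ← zpow_mul]
    rw [div_eq_mul_inv, ← zpow_neg, mul_left_comm, ← zpow_one_add₀ hb, mul_comm]
    congr 2
    · linear_combination -hxy
    · ring

/-- If `b ^ k / a ^ l` is real, then every ratio of two zeros of `a t ^ k + b t ^ l + 1` is real or
of modulus one, or there is a zero `t` and a further zero `t' ≠ t` of the same modulus. -/
theorem mem_realOrCircle_or_exists_norm_eq {k l : ℕ} (hkl : k.Coprime l)
    {a b t₁ t₂ : ℂ} (ha : a ≠ 0) (hk : k ≠ 0) (hr : (b ^ k / a ^ l).im = 0)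
    (h₁ : a * t₁ ^ k + b * t₁ ^ l + 1 = 0) (h₂ : a * t₂ ^ k + b * t₂ ^ l + 1 = 0) :
    t₁ / t₂ ∈ realOrCircle ∨ ∃ t t' : ℂ, a * t ^ k + b * t ^ l + 1 = 0 ∧
      a * t' ^ k + b * t' ^ l + 1 = 0 ∧ t ≠ t' ∧ ‖t‖ = ‖t'‖ := by
  -- If b = 0, all zeros satisfy t^k = -1/a, so their ratios are roots of unity.
  rcases eq_or_ne b 0 with rfl | hb
  · left
    right
    rw [zero_mul, add_zero] at h₁ h₂
    have hpow : a * t₁ ^ k = a * t₂ ^ k := by linear_combination h₁ - h₂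
    have ht₂ : t₂ ^ k ≠ 0 := by
      intro h0
      simp [h0] at h₂
    refine Complex.norm_eq_one_of_pow_eq_one ?_ hk
    rw [div_pow, mul_left_cancel₀ ha hpow, div_self ht₂]
  obtain ⟨c, hc, hac, hbc⟩ := exists_scaling_real hkl ha hb hr
  rw [← Complex.conj_eq_iff_im] at hac hbc
  -- A zero t with t/c nonreal is paired with c · conj(t/c).
  have key (t : ℂ) (ht : a * t ^ k + b * t ^ l + 1 = 0) (him : (t / c).im ≠ 0) :
      ∃ t t' : ℂ, a * t ^ k + b * t ^ l + 1 = 0 ∧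
        a * t' ^ k + b * t' ^ l + 1 = 0 ∧ t ≠ t' ∧ ‖t‖ = ‖t'‖ := by
    have hct : t = c * (t / c) := by field_simp
    refine ⟨t, c * conj (t / c), ht, ?_, fun heq => him ?_, ?_⟩
    · rw [hct, mul_pow, mul_pow, ← mul_assoc, ← mul_assoc] at ht
      have hconj := congrArg conj ht
      rw [map_add, map_add, map_mul, map_mul _ (b * c ^ l), hac, hbc, map_pow, map_pow, map_one,
        map_zero] at hconj
      rw [mul_pow, mul_pow, ← mul_assoc, ← mul_assoc, hconj]
    · rw [← Complex.conj_eq_iff_im]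
      exact mul_left_cancel₀ hc (heq.symm.trans hct)
    · rw [norm_mul, Complex.norm_conj, ← norm_mul, ← hct]
  by_cases him₁ : (t₁ / c).im = 0
  · by_cases him₂ : (t₂ / c).im = 0
    · left
      left
      rw [← Complex.conj_eq_iff_im] at him₁ him₂ ⊢
      rw [← div_div_div_cancel_right₀ hc, map_div₀, him₁, him₂]
    · exact Or.inr (key t₂ h₂ him₂)
  · exact Or.inr (key t₁ h₁ him₁)

end TrinomialRatio

open TrinomialRatio in
theorem mainTheorem3 (k l : ℕ) (hl : 1 ≤ l) (hlk : l < k) (hkl : Nat.Coprime k l)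
    (A B : Polynomial ℂ) (hA : A ≠ 0) (hB : B ≠ 0) (hAB : 1 ≤ (A * B).natDegree)
    (z₀ : ℂ)
    (hz₀ : z₀ ∈ TrinomialRatio.zerosOf (Set.range (TrinomialRatio.seqP A B k l)) \
      TrinomialRatio.zerosOf {A})
    (q : ℂ)
    (hq : q ∈ TrinomialRatio.distinctZeroRatios (TrinomialRatio.trinomialD A B k l z₀)) :
    q ∈ TrinomialRatio.domH k l ∧
      ((TrinomialRatio.h k l q).im = 0 ↔
        (q ∈ TrinomialRatio.realOrCircle ∩ TrinomialRatio.domH k l ∨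
          ∃ q' ∈ TrinomialRatio.distinctZeroRatios (TrinomialRatio.trinomialD A B k l z₀),
            q' ≠ q ∧ q' ∈ TrinomialRatio.realOrCircle ∩ TrinomialRatio.domH k l)) := by
  have ha : A.eval z₀ ≠ 0 := fun h0 => hz₀.2 ⟨A, rfl, hA, h0⟩
  have hk0 : k ≠ 0 := by omega
  have hl0 : l ≠ 0 := by omega
  have hratio : ∀ q ∈ distinctZeroRatios (trinomialD A B k l z₀), q ∈ domH k l ∧
      h k l q = (-1) ^ k * (B.eval z₀ ^ k / A.eval z₀ ^ l) := by
    rintro _ ⟨t₁, t₂, h₁, h₂, hne, rfl⟩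
    rw [isRoot_trinomialD_iff] at h₁ h₂
    have ht₁ := ne_zero_of_trinomial_eq_zero hk0 hl0 h₁
    have ht₂ := ne_zero_of_trinomial_eq_zero hk0 hl0 h₂
    rw [← div_mul_cancel₀ t₁ ht₂] at h₁
    have hdom := mem_domH_of_trinomial hlk hkl ha ht₂ (div_ne_zero ht₁ ht₂)
      (fun h1 => hne ((div_eq_one_iff_eq ht₂).mp h1)) h₁ h₂
    exact ⟨hdom, h_eq_of_trinomial hl hlk ha hdom h₁ h₂⟩
  refine ⟨(hratio q hq).1, fun hreal => ?_, ?_⟩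
  · have hr : (B.eval z₀ ^ k / A.eval z₀ ^ l).im = 0 := by
      rw [(hratio q hq).2, ← Complex.conj_eq_iff_im, map_mul, map_pow, map_neg, map_one] at hreal
      rw [← Complex.conj_eq_iff_im]
      exact mul_left_cancel₀ (pow_ne_zero _ (by norm_num)) hreal
    obtain ⟨t₁, t₂, h₁, h₂, -, hqt⟩ := id hq
    rw [isRoot_trinomialD_iff] at h₁ h₂
    rcases mem_realOrCircle_or_exists_norm_eq hkl ha hk0 hr h₁ h₂ with
      hmem | ⟨t, t', ht, ht', hne, hnorm⟩
    · exact Or.inl ⟨hqt ▸ hmem, (hratio q hq).1⟩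
    · have ht0 := ne_zero_of_trinomial_eq_zero hk0 hl0 ht'
      have hq' : t / t' ∈ distinctZeroRatios (trinomialD A B k l z₀) :=
        ⟨t, t', (isRoot_trinomialD_iff ..).mpr ht, (isRoot_trinomialD_iff ..).mpr ht', hne, rfl⟩
      have hmem : t / t' ∈ realOrCircle ∩ domH k l :=
        ⟨Or.inr (by rw [norm_div, hnorm, div_self (norm_ne_zero_iff.mpr ht0)]), (hratio _ hq').1⟩
      by_cases heq : t / t' = q
      · exact Or.inl (heq ▸ hmem)
      · exact Or.inr ⟨_, hq', heq, hmem⟩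
  · rintro (⟨hmem, -⟩ | ⟨q', hq', -, hmem, -⟩)
    · exact h_im_eq_zero hlk.le hmem
    · rw [(hratio q hq).2, ← (hratio q' hq').2]
      exact h_im_eq_zero hlk.le hmem
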